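/- Let $p$ be an odd prime and $n=2(p-1)$, and let $F_m$ denote the free group of rank $m$. Let $R_n$ be the rose with $n=p+(p-2)$ petals, with a marking, that is, an identification of $F_n$ with $\pi_1(R_n)$, the free group on the petals. Let $A\cong\mathbb{Z}/p$ be the subgroup of $Aut(F_n)$ generated by the automorphism which is induced by cyclically rotating the first $p$ petals and fixing the remaining $p-2$ petals. Then the normalizer of $A$ in $Aut(F_n)$ satisfies $$N_{Aut(F_n)}(A)\;\cong\; N_{\Sigma_p}(\mathbb{Z}/p)\times\bigl((F_{p-2}\times F_{p-2})\rtimes(\mathbb{Z}/2\times Aut(F_{p-2}))\bigr),$$ where $N_{\Sigma_p}(\mathbb{Z}/p)$ is the normalizer in the symmetric group $\Sigma_p$ of the subgroup generated by the $p$-cycle $(1\,2\,\cdots\,p)$, and where in the semidirect product $\mathbb{Z}/2$ acts by exchanging the two copies of $F_{p-2}$ and $Aut(F_{p-2})$ acts diagonally on the two copies of $F_{p-2}$. -/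

import Mathlib

namespace AutFreeRankTwo

/-- The free group of rank `n`. -/
abbrev F (n : ℕ) : Type := FreeGroup (Fin n)

/-- The petals of the rose with `2 (p - 1) = p + (p - 2)` petals: the first `p` petals, followed
by the remaining `p - 2` petals. -/
abbrev Petal (p : ℕ) : Type := Fin p ⊕ Fin (p - 2)

/-- The fundamental group of that rose at its vertex: the free group on its petals. -/
abbrev RoseGroup (p : ℕ) : Type := FreeGroup (Petal p)

/-- A marking of the rose, given by the isomorphism which it induces from `F_n`, `n = 2 (p - 1)`,
to the fundamental group of the rose. -/
abbrev Marking (p : ℕ) : Type := F (2 * (p - 1)) ≃* RoseGroup p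

/-- Markings exist, because `2 (p - 1) = p + (p - 2)`. -/
theorem nonempty_marking {p : ℕ} (hp : 2 ≤ p) : Nonempty (Marking p) :=
  ⟨FreeGroup.freeGroupCongr
    ((finCongr (show 2 * (p - 1) = p + (p - 2) by omega)).trans finSumFinEquiv.symm)⟩

/-- The rotation of the rose: it permutes the first `p` petals cyclically, and it fixes the other
`p - 2` petals. -/
def petalRotation (p : ℕ) : Equiv.Perm (Petal p) :=
  Equiv.sumCongr (finRotate p) (Equiv.refl (Fin (p - 2)))

/-- The automorphism of the fundamental group of the rose induced by the rotation. -/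
def roseRotation (p : ℕ) : MulAut (RoseGroup p) :=
  FreeGroup.freeGroupCongr (petalRotation p)

/-- The automorphism `η⁻¹ ∘ ρ ∘ η` of `F_n` by which the rotation `ρ` of the rose with marking `η`
acts on `F_n`. -/
def markedRotation (p : ℕ) (η : Marking p) : MulAut (F (2 * (p - 1))) :=
  (η.trans (roseRotation p)).trans η.symm

/-- The subgroup `A ≅ ℤ/p` of `Aut(F_n)`, `n = 2 (p - 1)`, given by the rotations of the first `p`
petals of the rose with marking `η`. -/
def subgroupA (p : ℕ) (η : Marking p) : Subgroup (MulAut (F (2 * (p - 1)))) :=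
  Subgroup.zpowers (markedRotation p η)

/-- The normalizer `N_{Σ_p}(ℤ/p)` in the symmetric group `Σ_p` of the subgroup `ℤ/p` generated by
the `p`-cycle `(1 2 … p)`. -/
def symNormalizer (p : ℕ) : Subgroup (Equiv.Perm (Fin p)) :=
  Subgroup.normalizer (Subgroup.zpowers (finRotate p) : Set (Equiv.Perm (Fin p)))

/-- `ℤ/2` acts on `G × G` by exchanging the two factors. -/
def swapAction (G : Type) [Group G] : Multiplicative (ZMod 2) →* MulAut (G × G) where
  toFun z := if z = 1 then 1 else MulEquiv.prodComm
  map_one' := if_pos rfl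
  map_mul' := by
    have h : ∀ z : Multiplicative (ZMod 2), z = 1 ∨ z = Multiplicative.ofAdd 1 := by decide
    have h1 : (Multiplicative.ofAdd 1 : Multiplicative (ZMod 2)) ≠ 1 := by decide
    have h2 : (Multiplicative.ofAdd 1 * Multiplicative.ofAdd 1 : Multiplicative (ZMod 2)) = 1 := by
      decide
    intro a b
    rcases h a with rfl | rfl <;> rcases h b with rfl | rfl <;>
      simp only [h1, h2, mul_one, one_mul, if_true, if_false]
    ext x <;> rfl

/-- `Aut(G)` acts diagonally on `G × G`. -/
def diagAction (G : Type) [Group G] : MulAut G →* MulAut (G × G) where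
  toFun α := MulEquiv.prodCongr α α
  map_one' := rfl
  map_mul' _ _ := rfl

theorem swapAction_commute_diagAction (G : Type) [Group G] (z : Multiplicative (ZMod 2))
    (α : MulAut G) : Commute (swapAction G z) (diagAction G α) := by
  change (if z = 1 then 1 else MulEquiv.prodComm) * diagAction G α
    = diagAction G α * (if z = 1 then 1 else MulEquiv.prodComm)
  split_ifs <;> rfl

/-- The action of `ℤ/2 × Aut(G)` on `G × G` for which `ℤ/2` exchanges the two factors and `Aut(G)`
acts diagonally. -/
def swapDiagAction (G : Type) [Group G] :
    Multiplicative (ZMod 2) × MulAut G →* MulAut (G × G) :=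
  (swapAction G).noncommCoprod (diagAction G) (swapAction_commute_diagAction G)

end AutFreeRankTwo

namespace RoseAutomorphism

open FreeGroup hiding map_mul map_inv map_one

variable {α X Y : Type*}

section Words

variable [DecidableEq α]

/-- Two elements of a free group split after their longest common prefix, and this prefix is all
that cancels in `g⁻¹ * h`. -/
theorem exists_common_prefix (g h : FreeGroup α) :
    ∃ P g' h' : List (α × Bool), g.toWord = P ++ g' ∧ h.toWord = P ++ h' ∧
      (g⁻¹ * h).toWord = invRev g' ++ h' ∧
      ∀ Q, Q <+: g.toWord → Q <+: h.toWord → Q <+: P := by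
  suffices H : ∀ l₁ l₂ : List (α × Bool), IsReduced l₁ → IsReduced l₂ →
      ∃ P l₁' l₂' : List (α × Bool), l₁ = P ++ l₁' ∧ l₂ = P ++ l₂' ∧
        IsReduced (invRev l₁' ++ l₂') ∧ ∀ Q, Q <+: l₁ → Q <+: l₂ → Q <+: P by
    obtain ⟨P, g', h', hg, hh, hr, hQ⟩ := H _ _ (isReduced_toWord (x := g))
      (isReduced_toWord (x := h))
    refine ⟨P, g', h', hg, hh, ?_, hQ⟩
    rw [← hr.reduce_eq, ← toWord_mk, toWord_inj, ← mul_mk, ← inv_mk]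
    rw [← mk_toWord (x := g), ← mk_toWord (x := h), hg, hh, ← mul_mk, ← mul_mk]
    group
  intro l₁
  induction l₁ with
  | nil => intro l₂ _ h₂; exact ⟨[], [], l₂, rfl, rfl, by simpa using h₂, fun Q h _ => h⟩
  | cons a l₁ ih =>
    intro l₂ h₁ h₂
    cases l₂ with
    | nil =>
      refine ⟨[], a :: l₁, [], rfl, rfl, ?_, fun Q _ h => h⟩
      rw [List.append_nil, isReduced_iff_reduce_eq, reduce_invRev, h₁.reduce_eq]
    | cons b l₂ =>
      by_cases hab : a = b
      · subst hab
        obtain ⟨P, l₁', l₂', e₁, e₂, hr, hQ⟩ := ih l₂ (h₁.infix (List.suffix_cons _ _).isInfix)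
          (h₂.infix (List.suffix_cons _ _).isInfix)
        refine ⟨a :: P, l₁', l₂', by simp [e₁], by simp [e₂], hr, fun Q hQ₁ hQ₂ => ?_⟩
        cases Q with
        | nil => exact List.nil_prefix
        | cons c Q =>
          rw [List.cons_prefix_cons] at hQ₁ hQ₂ ⊢
          exact ⟨hQ₁.1, hQ Q hQ₁.2 hQ₂.2⟩
      · refine ⟨[], a :: l₁, b :: l₂, rfl, rfl, ?_, fun Q hQ₁ hQ₂ => ?_⟩
        · have h₃ : IsReduced (invRev (a :: l₁)) := by
            rw [isReduced_iff_reduce_eq, reduce_invRev, h₁.reduce_eq]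
          rw [FreeGroup.IsReduced, List.isChain_append]
          refine ⟨h₃, h₂, ?_⟩
          intro x hx y hy hxy
          simp [invRev] at hx hy
          subst hx hy
          by_contra hne
          apply hab
          ext
          · exact hxy
          · revert hne; cases a.2 <;> cases b.2 <;> simp
        · cases Q with
          | nil => exact List.prefix_rfl
          | cons c Q =>
            rw [List.cons_prefix_cons] at hQ₁ hQ₂
            exact absurd (hQ₁.1.symm.trans hQ₂.1) hab

theorem toWord_map_of_injective {β : Type*} [DecidableEq β] {f : α → β}
    (hf : Function.Injective f) (g : FreeGroup α) :
    (FreeGroup.map f g).toWord = g.toWord.map fun a => (f a.1, a.2) := by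
  have hr : IsReduced (g.toWord.map fun a => (f a.1, a.2)) := by
    rw [FreeGroup.IsReduced, List.isChain_map]
    exact (isReduced_toWord (x := g)).imp fun a b hab h => hab (hf h)
  rw [← hr.reduce_eq, ← toWord_mk, ← map.mk, mk_toWord]

end Words

/-- The subword of the letters with generator in `X`. -/
def leftLetters (l : List ((X ⊕ Y) × Bool)) : List (X × Bool) :=
  l.filterMap fun a => a.1.getLeft?.map (·, a.2)

@[simp]
theorem leftLetters_nil : leftLetters ([] : List ((X ⊕ Y) × Bool)) = [] := rfl

@[simp]
theorem leftLetters_cons_inl (x : X) (e : Bool) (l : List ((X ⊕ Y) × Bool)) :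
    leftLetters ((Sum.inl x, e) :: l) = (x, e) :: leftLetters l := rfl

@[simp]
theorem leftLetters_cons_inr (y : Y) (e : Bool) (l : List ((X ⊕ Y) × Bool)) :
    leftLetters ((Sum.inr y, e) :: l) = leftLetters l := rfl

@[simp]
theorem leftLetters_append (l₁ l₂ : List ((X ⊕ Y) × Bool)) :
    leftLetters (l₁ ++ l₂) = leftLetters l₁ ++ leftLetters l₂ :=
  List.filterMap_append

theorem leftLetters_invRev (l : List ((X ⊕ Y) × Bool)) :
    leftLetters (invRev l) = invRev (leftLetters l) := by
  induction l with
  | nil => rfl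
  | cons a l ih =>
    rw [invRev_cons (L := l), leftLetters_append, ih]
    rcases a with ⟨x | y, e⟩
    · rw [leftLetters_cons_inl, invRev_cons (L := leftLetters l)]; rfl
    · simp [invRev]

theorem leftLetters_map_inr (l : List (Y × Bool)) :
    leftLetters (l.map fun a => ((Sum.inr a.1 : X ⊕ Y), a.2)) = [] := by
  induction l <;> simp_all

theorem exists_of_leftLetters_eq_nil {l : List ((X ⊕ Y) × Bool)} (h : leftLetters l = []) :
    ∃ l' : List (Y × Bool), l = l'.map fun a => (Sum.inr a.1, a.2) := by
  induction l with
  | nil => exact ⟨[], rfl⟩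
  | cons a l ih =>
    rcases a with ⟨x | y, e⟩
    · simp at h
    · obtain ⟨l', rfl⟩ := ih (by simpa using h)
      exact ⟨(y, e) :: l', rfl⟩

/-- A word splits before its first letter with generator in `X`. -/
theorem exists_split_of_leftLetters_eq_cons {l : List ((X ⊕ Y) × Bool)} {x : X} {e : Bool}
    {t : List (X × Bool)} (h : leftLetters l = (x, e) :: t) :
    ∃ u v, l = u ++ (Sum.inl x, e) :: v ∧ leftLetters u = [] ∧ leftLetters v = t := by
  induction l with
  | nil => simp at h
  | cons a l ih =>
    rcases a with ⟨x' | y, e'⟩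
    · simp only [leftLetters_cons_inl, List.cons.injEq, Prod.mk.injEq] at h
      obtain ⟨⟨rfl, rfl⟩, rfl⟩ := h
      exact ⟨[], l, rfl, rfl, rfl⟩
    · obtain ⟨u, v, rfl, hu, hv⟩ := ih (by simpa using h)
      exact ⟨(Sum.inr y, e') :: u, v, rfl, by simpa using hu, hv⟩

theorem leftLetters_map (σ : X → X) (l : List ((X ⊕ Y) × Bool)) :
    leftLetters (l.map fun a => (Sum.map σ id a.1, a.2))
      = (leftLetters l).map fun a => (σ a.1, a.2) := by
  induction l with
  | nil => rfl
  | cons a l ih => rcases a with ⟨x | y, e⟩ <;> simp [ih]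

theorem leftLetters_prefix {l₁ l₂ : List ((X ⊕ Y) × Bool)} (h : l₁ <+: l₂) :
    leftLetters l₁ <+: leftLetters l₂ := by
  obtain ⟨t, rfl⟩ := h
  exact ⟨leftLetters t, (leftLetters_append _ _).symm⟩

/-- The inclusion of the free group on `Y`. -/
def incl : FreeGroup Y →* FreeGroup (X ⊕ Y) := FreeGroup.map Sum.inr

theorem incl_injective : Function.Injective (incl : FreeGroup Y →* FreeGroup (X ⊕ Y)) :=
  map_injective Sum.inr_injective

theorem exists_incl_mk {l : List ((X ⊕ Y) × Bool)} (h : leftLetters l = []) :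
    ∃ k : FreeGroup Y, mk l = incl k := by
  obtain ⟨l', rfl⟩ := exists_of_leftLetters_eq_nil h
  exact ⟨mk l', rfl⟩

section Height

variable [DecidableEq X] [DecidableEq Y]

/-- The number of letters of the reduced word of `g` with generator in `X`. -/
def height (g : FreeGroup (X ⊕ Y)) : ℕ := (leftLetters g.toWord).length

theorem leftLetters_incl (k : FreeGroup Y) :
    leftLetters (incl k : FreeGroup (X ⊕ Y)).toWord = [] := by
  rw [incl, toWord_map_of_injective Sum.inr_injective, leftLetters_map_inr]

theorem height_incl (k : FreeGroup Y) : height (incl k : FreeGroup (X ⊕ Y)) = 0 := by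
  rw [height, leftLetters_incl, List.length_nil]

theorem exists_incl_of_height_eq_zero {g : FreeGroup (X ⊕ Y)} (h : height g = 0) :
    ∃ k : FreeGroup Y, g = incl k := by
  obtain ⟨k, hk⟩ := exists_incl_mk (List.length_eq_zero_iff.1 h)
  exact ⟨k, by rw [← hk, mk_toWord]⟩

theorem height_inv (g : FreeGroup (X ⊕ Y)) : height g⁻¹ = height g := by
  rw [height, toWord_inv, leftLetters_invRev, invRev_length, height]

theorem leftLetters_incl_mul (k : FreeGroup Y) (g : FreeGroup (X ⊕ Y)) :
    leftLetters (incl k * g).toWord = leftLetters g.toWord := by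
  obtain ⟨P, k', g', hk, hg, hkg, -⟩ := exists_common_prefix (incl k⁻¹ : FreeGroup (X ⊕ Y)) g
  have h := leftLetters_incl (X := X) k⁻¹
  rw [hk, leftLetters_append, List.append_eq_nil_iff] at h
  rw [map_inv, inv_inv] at hkg
  rw [hkg, hg, leftLetters_append, leftLetters_append, leftLetters_invRev, h.1, h.2]
  rfl

theorem height_incl_mul (k : FreeGroup Y) (g : FreeGroup (X ⊕ Y)) :
    height (incl k * g) = height g := by
  rw [height, leftLetters_incl_mul, height]

theorem height_mul_incl (g : FreeGroup (X ⊕ Y)) (k : FreeGroup Y) :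
    height (g * incl k) = height g := by
  rw [← height_inv, mul_inv_rev, ← map_inv, height_incl_mul, height_inv]

/-- Twice the Gromov product of `g` and `h`, for the distance `height (g⁻¹ * h)`. -/
def gromovProduct (g h : FreeGroup (X ⊕ Y)) : ℤ := height g + height h - height (g⁻¹ * h)

theorem exists_gromovProduct_eq (g h : FreeGroup (X ⊕ Y)) :
    ∃ P, P <+: g.toWord ∧ P <+: h.toWord ∧ gromovProduct g h = 2 * (leftLetters P).length ∧
      ∀ Q, Q <+: g.toWord → Q <+: h.toWord → Q <+: P := by
  obtain ⟨P, g', h', hg, hh, hgh, hQ⟩ := exists_common_prefix g h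
  refine ⟨P, ⟨g', hg.symm⟩, ⟨h', hh.symm⟩, ?_, hQ⟩
  simp only [gromovProduct, height, hg, hh, hgh, leftLetters_append, leftLetters_invRev,
    List.length_append, invRev_length]
  push_cast
  ring

theorem min_gromovProduct_le (g h k : FreeGroup (X ⊕ Y)) :
    min (gromovProduct g k) (gromovProduct k h) ≤ gromovProduct g h := by
  obtain ⟨P, -, -, e, hP⟩ := exists_gromovProduct_eq g h
  obtain ⟨P₁, h₁, h₁', e₁, -⟩ := exists_gromovProduct_eq g k
  obtain ⟨P₂, h₂, h₂', e₂, -⟩ := exists_gromovProduct_eq k h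
  rw [e, e₁, e₂]
  rcases List.prefix_or_prefix_of_prefix h₁' h₂ with h | h
  · have := (leftLetters_prefix (hP P₁ h₁ (h.trans h₂'))).length_le
    omega
  · have := (leftLetters_prefix (hP P₂ (h.trans h₁) h₂')).length_le
    omega

theorem gromovProduct_incl_mul_incl_mul (k : FreeGroup Y) (g h : FreeGroup (X ⊕ Y)) :
    gromovProduct (incl k * g) (incl k * h) = gromovProduct g h := by
  rw [gromovProduct, gromovProduct, height_incl_mul, height_incl_mul]
  congr 3
  group

end Height

section Rotation

/-- The endomorphism of the free group that permutes the generators in `X` by `σ`. -/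
def permMap (σ : Equiv.Perm X) : FreeGroup (X ⊕ Y) →* FreeGroup (X ⊕ Y) :=
  FreeGroup.map (Sum.map σ id)

theorem permMap_one (g : FreeGroup (X ⊕ Y)) : permMap 1 g = g := by
  rw [permMap, Equiv.Perm.coe_one, Sum.map_id_id, map.id]

theorem permMap_incl (σ : Equiv.Perm X) (k : FreeGroup Y) :
    permMap σ (incl k) = (incl k : FreeGroup (X ⊕ Y)) := by
  rw [permMap, incl, map.comp]
  rfl

variable [DecidableEq X] [DecidableEq Y]

theorem toWord_permMap (σ : Equiv.Perm X) (g : FreeGroup (X ⊕ Y)) :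
    (permMap σ g).toWord = g.toWord.map fun a => (Sum.map σ id a.1, a.2) :=
  toWord_map_of_injective (σ.injective.sumMap Function.injective_id) g

theorem leftLetters_permMap (σ : Equiv.Perm X) (g : FreeGroup (X ⊕ Y)) :
    leftLetters (permMap σ g).toWord = (leftLetters g.toWord).map fun a => (σ a.1, a.2) := by
  rw [toWord_permMap, leftLetters_map]

theorem height_permMap (σ : Equiv.Perm X) (g : FreeGroup (X ⊕ Y)) :
    height (permMap σ g) = height g := by
  rw [height, leftLetters_permMap, List.length_map, height]

theorem exists_incl_of_permMap_eq_self {σ : Equiv.Perm X} (hσ : ∀ x, σ x ≠ x)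
    {g : FreeGroup (X ⊕ Y)} (h : permMap σ g = g) : ∃ k : FreeGroup Y, g = incl k := by
  apply exists_incl_of_height_eq_zero
  have h₁ := leftLetters_permMap σ g
  rw [h] at h₁
  rw [height, List.length_eq_zero_iff]
  cases hl : leftLetters g.toWord with
  | nil => rfl
  | cons a t =>
    rw [hl] at h₁
    simp only [List.map_cons, List.cons.injEq] at h₁
    exact absurd (congrArg Prod.fst h₁.1).symm (hσ _)

/-- The translates of an element by the free group on `Y` and by a freely acting permutation of
`X` have no letter in `X` in their common prefixes. -/
theorem gromovProduct_incl_mul_permMap_le {σ : Equiv.Perm X} (hσ : σ = 1 ∨ ∀ x, σ x ≠ x)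
    (k : FreeGroup Y) (g : FreeGroup (X ⊕ Y)) (h : ¬ (k = 1 ∧ permMap σ g = g)) :
    gromovProduct g (incl k * permMap σ g) ≤ 0 := by
  by_contra! hpos
  obtain ⟨P, hP₁, hP₂, e, -⟩ := exists_gromovProduct_eq g (incl k * permMap σ g)
  rw [e] at hpos
  cases hl : leftLetters P with
  | nil => simp [hl] at hpos
  | cons a t =>
    obtain ⟨x, ε⟩ := a
    obtain ⟨u, v, rfl, hu, hv⟩ := exists_split_of_leftLetters_eq_cons hl
    obtain ⟨l, rfl⟩ := exists_of_leftLetters_eq_nil hu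
    obtain ⟨r, hr⟩ := hP₁
    obtain ⟨r', hr'⟩ := hP₂
    rw [List.append_assoc, List.cons_append] at hr hr'
    have hρ := toWord_permMap σ g
    rw [← hr, List.map_append, List.map_cons] at hρ
    have hid : ∀ l : List (Y × Bool), (l.map fun a => ((Sum.inr a.1 : X ⊕ Y), a.2)).map
        (fun a => (Sum.map σ id a.1, a.2)) = l.map fun a => (Sum.inr a.1, a.2) := by
      intro l; simp
    rw [hid] at hρ
    have hred : IsReduced (l.map fun a => ((Sum.inr a.1 : X ⊕ Y), a.2)) :=
      (isReduced_toWord (x := g)).infix (hr ▸ (List.prefix_append _ _).isInfix)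
    set tail := (v ++ r).map fun a => (Sum.map σ id a.1, a.2) with htail
    have hk : (incl k * permMap σ g).toWord =
        ((k * mk l).toWord.map fun a => ((Sum.inr a.1 : X ⊕ Y), a.2))
          ++ (Sum.inl (σ x), ε) :: tail := by
      have hR : IsReduced (((k * mk l).toWord.map fun a => ((Sum.inr a.1 : X ⊕ Y), a.2))
          ++ (Sum.inl (σ x), ε) :: tail) := by
        rw [FreeGroup.IsReduced, List.isChain_append]
        refine ⟨?_, ?_, ?_⟩
        · rw [← toWord_map_of_injective Sum.inr_injective]
          exact isReduced_toWord
        · refine (isReduced_toWord (x := permMap σ g)).infix ?_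
          rw [hρ]
          exact (List.suffix_append _ _).isInfix
        · intro a ha b hb hab
          rw [List.head?_cons, Option.mem_some_iff] at hb
          subst hb
          have := List.mem_of_mem_getLast? ha
          rw [List.mem_map] at this
          obtain ⟨c, -, rfl⟩ := this
          simp at hab
      rw [← hR.reduce_eq, ← toWord_mk, toWord_inj, ← mul_mk,
        ← toWord_map_of_injective Sum.inr_injective, mk_toWord, map_mul, mul_assoc]
      congr 1
      rw [← mk_toWord (x := permMap σ g), hρ, ← mul_mk]
      rfl
    rw [hk] at hr'
    have hinj : ∀ (l₁ l₂ : List (Y × Bool)) (x₁ x₂ : X) (t₁ t₂ : List ((X ⊕ Y) × Bool)),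
        (l₁.map fun a => ((Sum.inr a.1 : X ⊕ Y), a.2)) ++ (Sum.inl x₁, ε) :: t₁
          = (l₂.map fun a => ((Sum.inr a.1 : X ⊕ Y), a.2)) ++ (Sum.inl x₂, ε) :: t₂ →
        l₁ = l₂ ∧ x₁ = x₂ := by
      intro l₁
      induction l₁ with
      | nil => intro l₂; cases l₂ <;> simp +contextual
      | cons a l₁ ih =>
        intro l₂ x₁ x₂ t₁ t₂ h
        cases l₂ with
        | nil => simp at h
        | cons b l₂ =>
          simp only [List.map_cons, List.cons_append, List.cons.injEq, Prod.mk.injEq,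
            Sum.inr.injEq] at h
          obtain ⟨h₁, h₂⟩ := ih _ _ _ _ _ h.2
          exact ⟨by rw [h₁, Prod.ext h.1.1 h.1.2], h₂⟩
    obtain ⟨h₁, h₂⟩ := hinj _ _ _ _ _ _ hr'
    apply h
    constructor
    · have := congrArg mk h₁
      rw [mk_toWord] at this
      exact mul_eq_right.1 this.symm
    · rcases hσ with rfl | hσ
      · exact permMap_one g
      · exact absurd h₂.symm (hσ x)

/-- If `g` has odd height, then less than half of `g` cancels in products of `g` with its
translates: the middle letter would cancel with a letter of the same sign. -/
theorem gromovProduct_incl_mul_permMap_inv_lt (σ : Equiv.Perm X) (k : FreeGroup Y)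
    {g : FreeGroup (X ⊕ Y)} (hg : Odd (height g)) :
    gromovProduct g (incl k * permMap σ g⁻¹) < height g := by
  by_contra! hle
  obtain ⟨P, hP₁, hP₂, e, -⟩ := exists_gromovProduct_eq g (incl k * permMap σ g⁻¹)
  obtain ⟨q, hq⟩ := hg
  have hlen : q < (leftLetters P).length := by omega
  have h₁ := (leftLetters_prefix hP₁).getElem hlen
  have h₂ := (leftLetters_prefix hP₂).getElem hlen
  have h₃ := h₁.symm.trans h₂
  simp only [leftLetters_incl_mul, leftLetters_permMap, toWord_inv, leftLetters_invRev] at h₃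
  have hq' : (leftLetters g.toWord).length = 2 * q + 1 := hq
  simp only [invRev, List.getElem_map, List.getElem_reverse, List.length_map, hq'] at h₃
  have h₄ : 2 * q + 1 - 1 - q = q := by omega
  simp only [h₄] at h₃
  have := congrArg Prod.snd h₃
  simp at this

end Rotation

end RoseAutomorphism

namespace RoseAutomorphism

open FreeGroup hiding map_mul map_inv map_one

variable {X Y : Type*}

/-- The number of letters in `X`, modulo two. -/
def parity : FreeGroup (X ⊕ Y) →* Multiplicative (ZMod 2) :=
  FreeGroup.lift (Sum.elim (fun _ => Multiplicative.ofAdd 1) fun _ => 1)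

theorem parity_mk (l : List ((X ⊕ Y) × Bool)) :
    parity (mk l) = Multiplicative.ofAdd ((leftLetters l).length : ZMod 2) := by
  rw [parity, lift_mk]
  induction l with
  | nil => rfl
  | cons a l ih =>
    rw [List.map_cons, List.prod_cons, ih]
    rcases a with ⟨x | y, e⟩
    · have h : (Multiplicative.ofAdd (1 : ZMod 2))⁻¹ = Multiplicative.ofAdd 1 := by decide
      simp only [Sum.elim_inl, h, Bool.cond_self, leftLetters_cons_inl, List.length_cons]
      rw [← ofAdd_add]
      push_cast
      rw [add_comm]
    · simp

theorem permMap_letter (σ : Equiv.Perm X) (x : X) (e : Bool) :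
    permMap σ (mk [(Sum.inl x, e)] : FreeGroup (X ⊕ Y)) = mk [(Sum.inl (σ x), e)] := by
  rw [permMap, map.mk]
  rfl

theorem letter_inv (x : X) (e : Bool) :
    (mk [(Sum.inl x, e)] : FreeGroup (X ⊕ Y))⁻¹ = mk [(Sum.inl x, !e)] := by
  rw [inv_mk]
  rfl

theorem zpow_eq_one_or_forall_ne {σ : Equiv.Perm X} (hσ : ∀ a b, ∃ t : ℤ, (σ ^ t) a = b) (t : ℤ) :
    σ ^ t = 1 ∨ ∀ x, (σ ^ t) x ≠ x := by
  by_contra! h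
  obtain ⟨hne, x, hx⟩ := h
  apply hne
  ext y
  obtain ⟨s, rfl⟩ := hσ x y
  rw [← Equiv.Perm.mul_apply, ← zpow_add, add_comm, zpow_add, Equiv.Perm.mul_apply, hx]
  rfl

theorem exists_map_letter_eq_permMap {σ : Equiv.Perm X} {φ : MulAut (FreeGroup (X ⊕ Y))}
    (hφ : ∀ i j, ∃ t : ℤ, φ (of (Sum.inl j)) = permMap (σ ^ t) (φ (of (Sum.inl i))))
    (i j : X) (e : Bool) :
    ∃ t : ℤ, φ (mk [(Sum.inl j, e)]) = permMap (σ ^ t) (φ (mk [(Sum.inl i, e)])) := by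
  obtain ⟨t, ht⟩ := hφ i j
  refine ⟨t, ?_⟩
  cases e
  · have h : ∀ x : X, (mk [(Sum.inl x, false)] : FreeGroup (X ⊕ Y)) = (of (Sum.inl x))⁻¹ :=
      fun x => (letter_inv x true).symm
    rw [h, h, map_inv, map_inv, map_inv, ht]
  · exact ht

variable [DecidableEq X] [DecidableEq Y]

theorem parity_eq (g : FreeGroup (X ⊕ Y)) :
    parity g = Multiplicative.ofAdd (height g : ZMod 2) := by
  rw [height, ← parity_mk, mk_toWord]

theorem height_letter (x : X) (e : Bool) :
    height (mk [(Sum.inl x, e)] : FreeGroup (X ⊕ Y)) = 1 := by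
  rw [height, toWord_mk, reduce_singleton]
  rfl

section Automorphism

variable {σ : Equiv.Perm X} {φ : MulAut (FreeGroup (X ⊕ Y))}

theorem height_map_letter
    (hφ : ∀ i j, ∃ t : ℤ, φ (of (Sum.inl j)) = permMap (σ ^ t) (φ (of (Sum.inl i))))
    (i j : X) (e : Bool) :
    height (φ (mk [(Sum.inl j, e)])) = height (φ (of (Sum.inl i))) := by
  have h : height (φ (mk [(Sum.inl j, e)])) = height (φ (of (Sum.inl j))) := by
    cases e
    · rw [show (false : Bool) = !true from rfl, ← letter_inv, map_inv, height_inv]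
      rfl
    · rfl
  obtain ⟨t, ht⟩ := hφ i j
  rw [h, ht, height_permMap]

theorem odd_height_map_letter (hK : ∀ k, ∃ k', φ (incl k) = incl k')
    (hφ : ∀ i j, ∃ t : ℤ, φ (of (Sum.inl j)) = permMap (σ ^ t) (φ (of (Sum.inl i)))) (i : X) :
    Odd (height (φ (of (Sum.inl i)))) := by
  by_contra hodd
  rw [Nat.not_odd_iff_even] at hodd
  have hφ' : parity.comp φ.toMonoidHom = 1 := by
    ext a
    rcases a with x | y
    · have h := height_map_letter hφ i x true
      change parity (φ (mk [(Sum.inl x, true)])) = 1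
      rw [parity_eq, h, (ZMod.natCast_eq_zero_iff_even).2 hodd, ofAdd_zero]
    · obtain ⟨k, hk⟩ := hK (of y)
      have hy : (of (Sum.inr y) : FreeGroup (X ⊕ Y)) = incl (of y) := by rw [incl, map.of]
      change parity (φ (of (Sum.inr y))) = 1
      rw [hy, hk, parity_eq, height_incl]
      rfl
  have h := DFunLike.congr_fun hφ' (φ.symm (of (Sum.inl i)))
  have h' : parity (φ (φ.symm (of (Sum.inl i)))) = 1 := h
  rw [MulEquiv.apply_symm_apply, parity, lift_apply_of] at h'
  exact absurd h' (show Multiplicative.ofAdd (1 : ZMod 2) ≠ 1 by decide)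

theorem gromovProduct_map_letter_lt (hσ : ∀ a b, ∃ t : ℤ, (σ ^ t) a = b)
    (hK : ∀ k, ∃ k', φ (incl k) = incl k')
    (hφ : ∀ i j, ∃ t : ℤ, φ (of (Sum.inl j)) = permMap (σ ^ t) (φ (of (Sum.inl i))))
    (k : FreeGroup Y) (x x' : X) (e e' : Bool) (h : ¬ (k = 1 ∧ x = x' ∧ e ≠ e')) :
    gromovProduct (φ (mk [(Sum.inl x, e)]))⁻¹ (incl k * φ (mk [(Sum.inl x', e')]))
      < height (φ (of (Sum.inl x))) := by
  have hodd := odd_height_map_letter hK hφ x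
  by_cases he : e = e'
  · subst he
    obtain ⟨t, ht⟩ := exists_map_letter_eq_permMap hφ x x' e
    have hh : height (φ (mk [(Sum.inl x, e)]))⁻¹ = height (φ (of (Sum.inl x))) := by
      rw [height_inv, height_map_letter hφ x]
    rw [ht, ← hh]
    have := gromovProduct_incl_mul_permMap_inv_lt (σ ^ t) k (g := (φ (mk [(Sum.inl x, e)]))⁻¹)
      (hh ▸ hodd)
    rwa [inv_inv] at this
  · obtain rfl : e' = !e := by revert he; cases e <;> cases e' <;> simp
    obtain ⟨t, ht⟩ := exists_map_letter_eq_permMap hφ x x' (!e)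
    rw [← map_inv, letter_inv, ht]
    refine (gromovProduct_incl_mul_permMap_le (zpow_eq_one_or_forall_ne hσ t) k _ ?_).trans_lt ?_
    · rintro ⟨hk, hfix⟩
      rw [← ht] at hfix
      have := φ.injective hfix
      apply h
      refine ⟨hk, ?_, he⟩
      have := congrArg toWord this
      simp only [toWord_mk, reduce_singleton] at this
      simpa using this.symm
    · exact_mod_cast hodd.pos

theorem height_map_cons (hσ : ∀ a b, ∃ t : ℤ, (σ ^ t) a = b)
    (hK : ∀ k, ∃ k', φ (incl k) = incl k')
    (hφ : ∀ i j, ∃ t : ℤ, φ (of (Sum.inl j)) = permMap (σ ^ t) (φ (of (Sum.inl i))))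
    (i : X) (n : ℕ) : ∀ (x : X) (e : Bool) (l : List ((X ⊕ Y) × Bool)), l.length ≤ n →
      FreeGroup.IsReduced ((Sum.inl x, e) :: l) →
      height (φ (mk l)) < height (φ (mk ((Sum.inl x, e) :: l))) ∧
      height (φ (of (Sum.inl i))) ≤ height (φ (mk ((Sum.inl x, e) :: l))) := by
  induction n using Nat.strong_induction_on with
  | _ n ih =>
  intro x e l hl hred
  have hH := fun j e => height_map_letter hφ i j e
  have hpos := (odd_height_map_letter hK hφ i).pos
  have hcons : ∀ (x : X) (e : Bool) (l : List ((X ⊕ Y) × Bool)),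
      φ (mk ((Sum.inl x, e) :: l)) = φ (mk [(Sum.inl x, e)]) * φ (mk l) := by
    intro x e l
    rw [← map_mul, mul_mk]
    rfl
  cases hleft : leftLetters l with
  | nil =>
    obtain ⟨k, hk⟩ := exists_incl_mk hleft
    obtain ⟨k', hk'⟩ := hK k
    rw [hcons, hk, hk', height_mul_incl, hH, height_incl]
    exact ⟨hpos, le_rfl⟩
  | cons a t =>
    obtain ⟨x', e'⟩ := a
    obtain ⟨u, v, rfl, hu, -⟩ := exists_split_of_leftLetters_eq_cons hleft
    obtain ⟨k, hk⟩ := exists_incl_mk hu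
    obtain ⟨k', hk'⟩ := hK k
    have hlen : v.length < n := by
      rw [List.length_append, List.length_cons] at hl
      omega
    have hred' : FreeGroup.IsReduced ((Sum.inl x', e') :: v) :=
      hred.infix ((List.suffix_append u _).trans (List.suffix_cons _ _)).isInfix
    obtain ⟨ih₁, ih₂⟩ := ih v.length hlen x' e' v le_rfl hred'
    have hlt := gromovProduct_map_letter_lt hσ hK hφ k' x x' e e' (by
      rintro ⟨rfl, rfl, hne⟩
      rw [map_one, ← map_one φ] at hk'
      have h₁ := φ.injective hk'
      rw [h₁, one_eq_mk] at hk
      have hu' : FreeGroup.IsReduced u :=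
        hred.infix ((List.prefix_append u _).isInfix.trans (List.suffix_cons _ _).isInfix)
      have h₂ := congrArg toWord hk
      rw [toWord_mk, toWord_mk, hu'.reduce_eq, reduce_nil] at h₂
      subst h₂
      rw [List.nil_append, isReduced_cons_cons] at hred
      exact hne (hred.1 rfl))
    have hx : height (φ (of (Sum.inl x))) = height (φ (of (Sum.inl i))) := hH x true
    rw [hx] at hlt
    have hl' : φ (mk (u ++ (Sum.inl x', e') :: v)) =
        incl k' * φ (mk ((Sum.inl x', e') :: v)) := by
      rw [← mul_mk, map_mul, hk, hk']
    set Q := φ (mk ((Sum.inl x', e') :: v)) with hQ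
    set a := φ (mk [(Sum.inl x, e)]) with ha
    set b := φ (mk [(Sum.inl x', e')]) with hb
    have hQb : gromovProduct (incl k' * Q) (incl k' * b)
        = height Q + height b - height (φ (mk v)) := by
      rw [gromovProduct_incl_mul_incl_mul, gromovProduct, ← height_inv (φ (mk v)), hQ, hcons, ← hb]
      congr 3
      group
    have hmin := min_gromovProduct_le a⁻¹ (incl k' * b) (incl k' * Q)
    have hb' : height b = height (φ (of (Sum.inl i))) := hH x' e'
    have ha' : height a = height (φ (of (Sum.inl i))) := hH x e
    have hprod : gromovProduct a⁻¹ (incl k' * Q)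
        = height a + height Q - height (a * (incl k' * Q)) := by
      rw [gromovProduct, inv_inv, height_inv, height_incl_mul]
    rw [hcons x e, hl', ← ha, height_incl_mul]
    rw [hQb, hprod] at hmin
    rcases min_le_iff.1 hmin with h | h <;> constructor <;> omega

theorem height_map_letter_eq_one (hσ : ∀ a b, ∃ t : ℤ, (σ ^ t) a = b)
    (hK : ∀ k, ∃ k', φ (incl k) = incl k')
    (hφ : ∀ i j, ∃ t : ℤ, φ (of (Sum.inl j)) = permMap (σ ^ t) (φ (of (Sum.inl i)))) (i : X) :
    height (φ (of (Sum.inl i))) = 1 := by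
  obtain ⟨z, hz⟩ := φ.surjective (mk [(Sum.inl i, true)])
  have h₁ : height (φ z) = 1 := by rw [hz, height_letter]
  cases hleft : leftLetters z.toWord with
  | nil =>
    obtain ⟨k, hk⟩ := exists_incl_mk hleft
    obtain ⟨k', hk'⟩ := hK k
    rw [mk_toWord] at hk
    rw [hk, hk', height_incl] at h₁
    omega
  | cons a t =>
    obtain ⟨x, e⟩ := a
    obtain ⟨u, v, hz', hu, -⟩ := exists_split_of_leftLetters_eq_cons hleft
    obtain ⟨k, hk⟩ := exists_incl_mk hu
    obtain ⟨k', hk'⟩ := hK k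
    have hred : FreeGroup.IsReduced ((Sum.inl x, e) :: v) :=
      (isReduced_toWord (x := z)).infix (hz' ▸ (List.suffix_append u _).isInfix)
    have h₂ := (height_map_cons hσ hK hφ i v.length x e v le_rfl hred).2
    rw [← mk_toWord (x := z), hz', ← mul_mk, map_mul, hk, hk', height_incl_mul] at h₁
    have := (odd_height_map_letter hK hφ i).pos
    omega

/-- An automorphism that preserves the free group on `Y`, and for which the images of the
generators in `X` are translates of each other under a transitive cyclic group of permutations,
maps the generators in `X` to generators in `X` or their inverses, up to multiplication by elements
of the free group on `Y`. -/
theorem exists_map_letter_eq [Finite X] [Nonempty X] (hσ : ∀ a b, ∃ t : ℤ, (σ ^ t) a = b)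
    (hK : ∀ k, ∃ k', φ (incl k) = incl k')
    (hφ : ∀ i j, ∃ t : ℤ, φ (of (Sum.inl j)) = permMap (σ ^ t) (φ (of (Sum.inl i)))) :
    ∃ (a b : FreeGroup Y) (e : Bool) (τ : Equiv.Perm X), ∀ x,
      φ (of (Sum.inl x)) = incl a * mk [(Sum.inl (τ x), e)] * incl b := by
  obtain ⟨i⟩ := ‹Nonempty X›
  have h₁ := height_map_letter_eq_one hσ hK hφ i
  rw [height, List.length_eq_one_iff] at h₁
  obtain ⟨⟨s, e⟩, h₁⟩ := h₁
  obtain ⟨u, v, h₂, hu, hv⟩ := exists_split_of_leftLetters_eq_cons h₁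
  obtain ⟨a, ha⟩ := exists_incl_mk hu
  obtain ⟨b, hb⟩ := exists_incl_mk hv
  have hi : φ (of (Sum.inl i)) = incl a * mk [(Sum.inl s, e)] * incl b := by
    rw [← ha, ← hb, mul_mk, mul_mk, List.append_assoc, List.singleton_append, ← h₂, mk_toWord]
  have hx : ∀ x, ∃ s, φ (of (Sum.inl x)) = incl a * mk [(Sum.inl s, e)] * incl b := by
    intro x
    obtain ⟨t, ht⟩ := hφ i x
    refine ⟨(σ ^ t) s, ?_⟩
    rw [ht, hi, map_mul, map_mul, permMap_incl, permMap_incl, permMap_letter]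
  choose τ hτ using hx
  have hinj : Function.Injective τ := by
    intro x y hxy
    have h : φ (of (Sum.inl x)) = φ (of (Sum.inl y)) := by rw [hτ, hτ, hxy]
    exact Sum.inl_injective (of_injective (φ.injective h))
  exact ⟨a, b, e, Equiv.ofBijective τ (Finite.injective_iff_bijective.1 hinj), hτ⟩

end Automorphism

end RoseAutomorphism

namespace RoseAutomorphism

open FreeGroup hiding map_mul map_inv map_one
open AutFreeRankTwo

/-- The group of pairs of elements of `K`, extended by the exchange of the two entries and by the
automorphisms of `K`. -/
abbrev PairExtension (K : Type) [Group K] : Type :=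
  (K × K) ⋊[swapDiagAction K] (Multiplicative (ZMod 2) × MulAut K)

theorem swapDiagAction_one_apply {K : Type} [Group K] (α : MulAut K) (a : K × K) :
    swapDiagAction K (1, α) a = (α a.1, α a.2) := by
  simp [swapDiagAction, swapAction]
  rfl

theorem swapDiagAction_apply_of_ne {K : Type} [Group K] {z : Multiplicative (ZMod 2)} (hz : z ≠ 1)
    (α : MulAut K) (a : K × K) : swapDiagAction K (z, α) a = (α a.2, α a.1) := by
  simp [swapDiagAction, swapAction, hz]
  rfl

/-- The action of `ℤ/2` on a group by inversion. -/
def signed {G : Type*} [Group G] (z : Multiplicative (ZMod 2)) (g : G) : G :=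
  if z = 1 then g else g⁻¹

theorem signed_one {G : Type*} [Group G] (g : G) : signed 1 g = g := if_pos rfl

theorem signed_of_ne {G : Type*} [Group G] {z : Multiplicative (ZMod 2)} (hz : z ≠ 1) (g : G) :
    signed z g = g⁻¹ := if_neg hz

theorem signed_mul_of_ne {G : Type*} [Group G] {z : Multiplicative (ZMod 2)} (hz : z ≠ 1)
    (z' : Multiplicative (ZMod 2)) (g : G) : signed (z * z') g = signed z' g⁻¹ := by
  have h : ∀ z : Multiplicative (ZMod 2), z = 1 ∨ z = Multiplicative.ofAdd 1 := by decide
  have h1 : (Multiplicative.ofAdd 1 : Multiplicative (ZMod 2)) ≠ 1 := by decide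
  have h2 : (Multiplicative.ofAdd 1 * Multiplicative.ofAdd 1 : Multiplicative (ZMod 2)) = 1 := by
    decide
  obtain rfl := (h z).resolve_left hz
  rcases h z' with rfl | rfl
  · rw [mul_one, signed_of_ne h1, signed_one]
  · rw [h2, signed_one, signed_of_ne h1, inv_inv]

theorem map_signed {G H : Type*} [Group G] [Group H] (f : G →* H) (z : Multiplicative (ZMod 2))
    (g : G) : f (signed z g) = signed z (f g) := by
  unfold signed
  split_ifs
  · rfl
  · exact map_inv f g

variable {X Y : Type}

/-- The endomorphism with `x ↦ (a⁻¹ * τ x * b) ^ (± 1)` and `y ↦ α y`. -/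
def pairEnd (γ : Equiv.Perm X × PairExtension (FreeGroup Y)) :
    FreeGroup (X ⊕ Y) →* FreeGroup (X ⊕ Y) :=
  FreeGroup.lift (Sum.elim
    (fun x => signed γ.2.right.1
      ((incl γ.2.left.1)⁻¹ * of (Sum.inl (γ.1 x)) * incl γ.2.left.2))
    fun y => incl (γ.2.right.2 (of y)))

theorem pairEnd_of_inl (γ : Equiv.Perm X × PairExtension (FreeGroup Y)) (x : X) :
    pairEnd γ (of (Sum.inl x)) = signed γ.2.right.1
      ((incl γ.2.left.1)⁻¹ * of (Sum.inl (γ.1 x)) * incl γ.2.left.2) := by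
  rw [pairEnd, lift_apply_of]
  rfl

theorem incl_of (y : Y) : (incl (of y) : FreeGroup (X ⊕ Y)) = of (Sum.inr y) := by
  rw [incl, map.of]

theorem pairEnd_incl (γ : Equiv.Perm X × PairExtension (FreeGroup Y)) (k : FreeGroup Y) :
    pairEnd γ (incl k) = incl (γ.2.right.2 k) := by
  have h : (pairEnd γ).comp incl = incl.comp γ.2.right.2.toMonoidHom := by
    ext y
    change pairEnd γ (incl (of y)) = incl (γ.2.right.2 (of y))
    rw [incl_of, pairEnd, lift_apply_of]
    rfl
  exact DFunLike.congr_fun h k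

theorem pairEnd_one : pairEnd (1 : Equiv.Perm X × PairExtension (FreeGroup Y))
    = MonoidHom.id _ := by
  ext a
  rcases a with x | y
  · rw [pairEnd_of_inl]
    simp [signed_one]
  · rw [← incl_of, pairEnd_incl]
    rfl

theorem pairEnd_mul (γ γ' : Equiv.Perm X × PairExtension (FreeGroup Y)) :
    pairEnd (γ * γ') = (pairEnd γ).comp (pairEnd γ') := by
  ext a
  rw [MonoidHom.comp_apply]
  rcases a with x | y
  · rw [pairEnd_of_inl, pairEnd_of_inl, map_signed, map_mul, map_mul, map_inv, pairEnd_incl,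
      pairEnd_incl, pairEnd_of_inl]
    obtain ⟨τ, ⟨⟨a, b⟩, ⟨z, α⟩⟩⟩ := γ
    obtain ⟨τ', ⟨⟨a', b'⟩, ⟨z', α'⟩⟩⟩ := γ'
    by_cases hz : z = 1
    · subst hz
      simp only [Prod.mk_mul_mk, SemidirectProduct.mul_def, swapDiagAction_one_apply, one_mul,
        Equiv.Perm.mul_apply, signed_one, map_mul, mul_inv_rev, mul_assoc]
    · simp only [Prod.mk_mul_mk, SemidirectProduct.mul_def, swapDiagAction_apply_of_ne hz,
        Equiv.Perm.mul_apply, signed_of_ne hz, signed_mul_of_ne hz, map_mul, mul_inv_rev, inv_inv,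
        mul_assoc]
  · rw [← incl_of, pairEnd_incl, pairEnd_incl, pairEnd_incl]
    rfl

/-- The automorphisms with `x ↦ (a⁻¹ * τ x * b) ^ (± 1)` and `y ↦ α y`. -/
def pairAut : Equiv.Perm X × PairExtension (FreeGroup Y) →* MulAut (FreeGroup (X ⊕ Y)) where
  toFun γ := MonoidHom.toMulEquiv (pairEnd γ) (pairEnd γ⁻¹)
    (by rw [← pairEnd_mul, inv_mul_cancel, pairEnd_one])
    (by rw [← pairEnd_mul, mul_inv_cancel, pairEnd_one])
  map_one' := MulEquiv.ext fun g => DFunLike.congr_fun pairEnd_one g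
  map_mul' γ γ' := MulEquiv.ext fun g => DFunLike.congr_fun (pairEnd_mul γ γ') g

theorem pairAut_perm_apply (τ : Equiv.Perm X) (g : FreeGroup (X ⊕ Y)) :
    pairAut (τ, 1) g = permMap τ g := by
  have h : pairEnd (τ, (1 : PairExtension (FreeGroup Y))) = permMap τ := by
    ext a
    rcases a with x | y
    · rw [pairEnd_of_inl]
      simp [signed_one, permMap]
    · rw [← incl_of, pairEnd_incl, permMap_incl]
      rfl
  exact DFunLike.congr_fun h g

/-- The homomorphism that kills `X`. -/
def retract : FreeGroup (X ⊕ Y) →* FreeGroup Y := FreeGroup.lift (Sum.elim (fun _ => 1) of)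

theorem retract_incl (k : FreeGroup Y) : retract (incl k : FreeGroup (X ⊕ Y)) = k := by
  have h : (retract : FreeGroup (X ⊕ Y) →* FreeGroup Y).comp incl = MonoidHom.id _ := by
    ext y
    rw [MonoidHom.comp_apply, incl_of, retract, lift_apply_of]
    rfl
  exact DFunLike.congr_fun h k

/-- The restriction of an automorphism to the free group on `Y`, if it preserves it. -/
theorem exists_restriction {φ : MulAut (FreeGroup (X ⊕ Y))}
    (h : ∀ k : FreeGroup Y, ∃ k', φ (incl k) = incl k')
    (h' : ∀ k : FreeGroup Y, ∃ k', φ⁻¹ (incl k) = incl k') :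
    ∃ α : MulAut (FreeGroup Y), ∀ k, φ (incl k) = incl (α k) := by
  have key : ∀ ψ : MulAut (FreeGroup (X ⊕ Y)), (∀ k : FreeGroup Y, ∃ k', ψ (incl k) = incl k') →
      ∀ k, incl (retract (ψ (incl k))) = ψ (incl k) := by
    intro ψ hψ k
    obtain ⟨k', hk'⟩ := hψ k
    rw [hk', retract_incl]
  refine ⟨MonoidHom.toMulEquiv ((retract.comp φ.toMonoidHom).comp incl)
    ((retract.comp (φ⁻¹).toMonoidHom).comp incl) ?_ ?_, fun k => (key φ h k).symm⟩
  · refine MonoidHom.ext fun k => ?_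
    change retract (φ⁻¹ (incl (retract (φ (incl k))))) = k
    rw [key φ h, MulAut.inv_apply_self, retract_incl]
  · refine MonoidHom.ext fun k => ?_
    change retract (φ (incl (retract (φ⁻¹ (incl k))))) = k
    rw [key _ h', MulAut.apply_inv_self, retract_incl]

variable [DecidableEq X] [DecidableEq Y]

theorem eq_of_incl_mul_letter_mul_incl_eq {a b : FreeGroup Y} {s x : X} {e : Bool}
    (h : incl a * mk [(Sum.inl s, e)] * incl b = of (Sum.inl x)) :
    a = 1 ∧ b = 1 ∧ s = x ∧ e = true := by
  have hl : leftLetters (mk [(Sum.inl s, e)] : FreeGroup (X ⊕ Y)).toWord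
      = leftLetters (of (Sum.inl x) * incl b⁻¹ : FreeGroup (X ⊕ Y)).toWord := by
    rw [← h, map_inv, mul_inv_cancel_right, leftLetters_incl_mul]
  have hr : ∀ (g : FreeGroup (X ⊕ Y)) (k : FreeGroup Y),
      leftLetters (g * incl k).toWord = leftLetters g.toWord := by
    intro g k
    apply invRev_injective
    rw [← leftLetters_invRev, ← leftLetters_invRev, ← toWord_inv, ← toWord_inv, mul_inv_rev,
      ← map_inv, leftLetters_incl_mul]
  rw [hr, toWord_of, toWord_mk, reduce_singleton] at hl
  simp only [leftLetters_cons_inl, leftLetters_nil, List.cons.injEq, Prod.mk.injEq,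
    and_true] at hl
  obtain ⟨rfl, rfl⟩ := hl
  have ha : a = 1 := by
    by_contra ha
    have hle := gromovProduct_incl_mul_permMap_le (X := X) (Or.inl rfl) a (of (Sum.inl s))
      (fun h => ha h.1)
    have hab : incl a * of (Sum.inl s) = of (Sum.inl s) * (incl b⁻¹ : FreeGroup (X ⊕ Y)) := by
      rw [map_inv, eq_mul_inv_iff_mul_eq]
      exact h
    rw [permMap_one, gromovProduct, height_incl_mul, hab, inv_mul_cancel_left, height_incl] at hle
    have h₁ : height (of (Sum.inl s) : FreeGroup (X ⊕ Y)) = 1 := height_letter s true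
    rw [h₁] at hle
    norm_num at hle
  refine ⟨ha, ?_, rfl, rfl⟩
  subst ha
  rw [map_one, one_mul] at h
  apply incl_injective (X := X)
  rw [map_one]
  exact mul_eq_left.1 h

theorem pairAut_injective [Nonempty X] :
    Function.Injective (pairAut : Equiv.Perm X × PairExtension (FreeGroup Y) →* _) := by
  rw [injective_iff_map_eq_one]
  rintro ⟨τ, ⟨⟨a, b⟩, ⟨z, α⟩⟩⟩ h
  have hg : ∀ g, pairEnd (τ, ⟨(a, b), (z, α)⟩) g = g := fun g => DFunLike.congr_fun h g
  have hα : α = 1 := by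
    ext1 k
    have := hg (incl k)
    rw [pairEnd_incl] at this
    exact incl_injective this
  have hx : ∀ x, z = 1 ∧ a = 1 ∧ b = 1 ∧ τ x = x := by
    intro x
    have hx := hg (of (Sum.inl x))
    rw [pairEnd_of_inl] at hx
    by_cases hz : z = 1
    · simp only [hz, signed_one] at hx
      rw [← map_inv] at hx
      obtain ⟨h₁, h₂, h₃, -⟩ := eq_of_incl_mul_letter_mul_incl_eq (e := true) hx
      exact ⟨hz, inv_eq_one.1 h₁, h₂, h₃⟩
    · simp only [signed_of_ne hz] at hx
      rw [mul_inv_rev, mul_inv_rev, inv_inv, ← map_inv, ← mul_assoc] at hx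
      exact absurd (eq_of_incl_mul_letter_mul_incl_eq (e := false) hx).2.2.2 (by simp)
  obtain ⟨rfl, rfl, rfl, -⟩ := hx (Classical.arbitrary X)
  obtain rfl : τ = 1 := Equiv.ext fun x => (hx x).2.2.2
  subst hα
  rfl

/-- The automorphisms that normalize a transitive cyclic group of permutations of `X`. -/
theorem normalizer_zpowers_le_range_pairAut [Finite X] [Nontrivial X] {σ : Equiv.Perm X}
    (hσ : ∀ a b, ∃ t : ℤ, (σ ^ t) a = b) :
    Subgroup.normalizer (Subgroup.zpowers (pairAut (σ, (1 : PairExtension (FreeGroup Y)))) :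
      Set (MulAut (FreeGroup (X ⊕ Y)))) ≤ pairAut.range := by
  intro φ hφ
  have hpow : ∀ (t : ℤ) (g : FreeGroup (X ⊕ Y)),
      (pairAut (σ, (1 : PairExtension (FreeGroup Y))) ^ t) g = permMap (σ ^ t) g := by
    intro t g
    rw [← map_zpow, Prod.pow_mk, one_zpow, pairAut_perm_apply]
  have hconj : ∀ {ψ : MulAut (FreeGroup (X ⊕ Y))},
      ψ ∈ Subgroup.normalizer (Subgroup.zpowers (pairAut (σ, (1 : PairExtension (FreeGroup Y)))) :
        Set (MulAut (FreeGroup (X ⊕ Y)))) →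
      ∀ t : ℤ, ∃ s : ℤ, ∀ g, ψ (permMap (σ ^ t) g) = permMap (σ ^ s) (ψ g) := by
    intro ψ hψ t
    obtain ⟨s, hs⟩ := Subgroup.mem_zpowers_iff.1
      ((Subgroup.mem_normalizer_iff.1 hψ _).1 (Subgroup.zpow_mem_zpowers _ t))
    refine ⟨s, fun g => ?_⟩
    rw [← hpow, ← hpow, hs, MulAut.mul_apply, MulAut.mul_apply, MulAut.inv_apply_self]
  have hfix : ∀ x, σ x ≠ x := by
    have := zpow_eq_one_or_forall_ne hσ 1
    rw [zpow_one] at this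
    refine this.resolve_left ?_
    rintro rfl
    obtain ⟨a, b, hab⟩ := exists_pair_ne X
    obtain ⟨t, ht⟩ := hσ a b
    rw [one_zpow] at ht
    exact hab ht
  have hK : ∀ {ψ : MulAut (FreeGroup (X ⊕ Y))},
      ψ ∈ Subgroup.normalizer (Subgroup.zpowers (pairAut (σ, (1 : PairExtension (FreeGroup Y)))) :
        Set (MulAut (FreeGroup (X ⊕ Y)))) →
      ∀ k : FreeGroup Y, ∃ k', ψ (incl k) = incl k' := by
    intro ψ hψ k
    apply exists_incl_of_permMap_eq_self hfix
    obtain ⟨s, hs⟩ := hconj ((Subgroup.normalizer _).inv_mem hψ) 1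
    have h := hs (ψ (incl k))
    rw [MulAut.inv_apply_self, permMap_incl, zpow_one, MulAut.inv_apply, MulEquiv.symm_apply_eq]
      at h
    exact h
  have hφ' : ∀ i j, ∃ t : ℤ, φ (of (Sum.inl j)) = permMap (σ ^ t) (φ (of (Sum.inl i))) := by
    intro i j
    obtain ⟨t, rfl⟩ := hσ i j
    obtain ⟨s, hs⟩ := hconj hφ t
    refine ⟨s, ?_⟩
    rw [← hs]
    exact congrArg φ (permMap_letter (σ ^ t) i true).symm
  obtain ⟨α, hα⟩ := exists_restriction (hK hφ) (hK ((Subgroup.normalizer _).inv_mem hφ))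
  obtain ⟨a, b, e, τ, hτ⟩ := exists_map_letter_eq hσ (hK hφ) hφ'
  have hend : ∀ γ : Equiv.Perm X × PairExtension (FreeGroup Y), γ.2.right.2 = α →
      (∀ x, pairEnd γ (of (Sum.inl x)) = φ (of (Sum.inl x))) → pairAut γ = φ := by
    intro γ hγ hx
    have h : pairEnd γ = φ.toMonoidHom := by
      ext c
      rcases c with x | y
      · exact hx x
      · rw [← incl_of, pairEnd_incl, hγ]
        exact (hα _).symm
    exact MulEquiv.ext fun g => DFunLike.congr_fun h g
  cases e
  · have h1 : (Multiplicative.ofAdd 1 : Multiplicative (ZMod 2)) ≠ 1 := by decide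
    refine ⟨(τ, ⟨(b, a⁻¹), (Multiplicative.ofAdd 1, α)⟩), hend _ rfl fun x => ?_⟩
    rw [pairEnd_of_inl, hτ, signed_of_ne h1, mul_inv_rev, mul_inv_rev, inv_inv, map_inv, inv_inv,
      mul_assoc]
    rfl
  · refine ⟨(τ, ⟨(a⁻¹, b), (1, α)⟩), hend _ rfl fun x => ?_⟩
    rw [pairEnd_of_inl, hτ, signed_one, map_inv, inv_inv]
    rfl

theorem normalizer_zpowers_prod_one {P R : Type*} [Group P] [Group R] (σ : P) :
    Subgroup.normalizer (Subgroup.zpowers ((σ, 1) : P × R) : Set (P × R))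
      = (Subgroup.normalizer (Subgroup.zpowers σ : Set P)).prod ⊤ := by
  have hmem : ∀ (τ : P) (r : R), (τ, r) ∈ Subgroup.zpowers ((σ, 1) : P × R) ↔
      τ ∈ Subgroup.zpowers σ ∧ r = 1 := by
    intro τ r
    simp only [Subgroup.mem_zpowers_iff, Prod.pow_mk, one_zpow, Prod.mk.injEq, exists_and_right,
      eq_comm (a := (1 : R))]
  ext ⟨τ, r⟩
  simp only [Subgroup.mem_prod, Subgroup.mem_top, and_true, Subgroup.mem_normalizer_iff,
    Prod.forall, Prod.inv_mk, Prod.mk_mul_mk, hmem, conj_eq_one_iff]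
  exact ⟨fun h t => by simpa using h t 1, fun h t s => by rw [h t]⟩

theorem nonempty_normalizer_zpowers_mulEquiv {P R G : Type*} [Group P] [Group R] [Group G]
    {f : P × R →* G} (hf : Function.Injective f) {σ : P}
    (h : Subgroup.normalizer (Subgroup.zpowers (f (σ, 1)) : Set G) ≤ f.range) :
    Nonempty (Subgroup.normalizer (Subgroup.zpowers (f (σ, 1)) : Set G) ≃*
      Subgroup.normalizer (Subgroup.zpowers σ : Set P) × R) := by
  have hcomap : (Subgroup.zpowers (f (σ, 1))).comap f = Subgroup.zpowers (σ, 1) := by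
    rw [← MonoidHom.map_zpowers, Subgroup.comap_map_eq_self_of_injective hf]
  have hle := Subgroup.le_normalizer.trans h
  have hN : Subgroup.normalizer (Subgroup.zpowers (f (σ, 1)) : Set G)
      = ((Subgroup.normalizer (Subgroup.zpowers σ : Set P)).prod (⊤ : Subgroup R)).map f := by
    rw [← normalizer_zpowers_prod_one, ← hcomap, ← Subgroup.comap_normalizer_eq_of_le_range hle,
      Subgroup.map_comap_eq_self h]
  exact ⟨(MulEquiv.subgroupCongr hN).trans
    ((Subgroup.equivMapOfInjective _ f hf).symm.trans
      ((Subgroup.prodEquiv _ _).trans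
        ((MulEquiv.refl _).prodCongr Subgroup.topEquiv)))⟩

end RoseAutomorphism

theorem lemma5p5 (p : ℕ) (hp : p.Prime) (hodd : p ≠ 2) (η : AutFreeRankTwo.Marking p) :
    Nonempty
      (↥(Subgroup.normalizer
          (AutFreeRankTwo.subgroupA p η : Set (MulAut (AutFreeRankTwo.F (2 * (p - 1)))))) ≃*
        ↥(AutFreeRankTwo.symNormalizer p) ×
          ((AutFreeRankTwo.F (p - 2) × AutFreeRankTwo.F (p - 2))
            ⋊[AutFreeRankTwo.swapDiagAction (AutFreeRankTwo.F (p - 2))]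
              (Multiplicative (ZMod 2) × MulAut (AutFreeRankTwo.F (p - 2))))) := by
  have : Nontrivial (Fin p) := Fin.nontrivial_iff_two_le.2 hp.two_le
  have hσ : ∀ a b, ∃ t : ℤ, (finRotate p ^ t) a = b := by
    intro a b
    have hmem : ∀ x, finRotate p x ≠ x := fun x => by
      rw [← Equiv.Perm.mem_support, support_finRotate_of_le hp.two_le]
      exact Finset.mem_univ x
    exact (isCycle_finRotate_of_le hp.two_le).exists_zpow_eq (hmem a) (hmem b)
  let ρ : MulAut (AutFreeRankTwo.RoseGroup p) := RoseAutomorphism.pairAut (finRotate p, 1)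
  have hρ : (MulAut.congr η) (AutFreeRankTwo.markedRotation p η) = ρ := by
    refine MulEquiv.ext fun g => ?_
    rw [RoseAutomorphism.pairAut_perm_apply]
    simp only [AutFreeRankTwo.markedRotation, MulAut.congr_apply, MulEquiv.trans_apply,
      MulEquiv.apply_symm_apply]
    rfl
  have hmap : (Subgroup.normalizer
      (AutFreeRankTwo.subgroupA p η : Set (MulAut (AutFreeRankTwo.F (2 * (p - 1)))))).map
      (MulAut.congr η).toMonoidHom = Subgroup.normalizer (Subgroup.zpowers ρ : Set _) := by
    rw [Subgroup.map_equiv_normalizer_eq, AutFreeRankTwo.subgroupA, MonoidHom.map_zpowers, ← hρ]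
    rfl
  obtain ⟨f⟩ := RoseAutomorphism.nonempty_normalizer_zpowers_mulEquiv
    RoseAutomorphism.pairAut_injective
    (RoseAutomorphism.normalizer_zpowers_le_range_pairAut (Y := Fin (p - 2)) hσ)
  exact ⟨((MulAut.congr η).subgroupMap _).trans ((MulEquiv.subgroupCongr hmap).trans f)⟩
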